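/- **Theorem (continuous-time convergence of $u(t)$).** Let $X$ be a real Banach space, $T:X\to X$ a nonexpansive map (i.e. $\|Tx-Ty\|\le\|x-y\|$ for all $x,y\in X$), and let $\mathrm{Fix}(T)=\{x\in X: Tx=x\}$. Let $f:[0,\infty)\to X$ and $\epsilon:[0,\infty)\to\mathbb R$ be continuous with $\|f(t)\|\le\epsilon(t)$ for all $t\ge 0$, let $x_0\in X$, and let $u:[0,\infty)\to X$ be the solution of $$u'(t)+(I-T)u(t)=f(t)\quad(t\ge 0),\qquad u(0)=x_0. \tag{E}$$ Suppose that $\int_0^\infty\epsilon(s)\,ds<\infty$ and $\|u(t)-Tu(t)\|\to 0$ as $t\to\infty$. a) If $T(C)$ is relatively compact for some set $C\subseteq X$ with $u(t)\in C$ for all $t\ge 0$ (for instance $C=X$), then $u(t)$ converges strongly, as $t\to\infty$, to a fixed point of $T$. b) If $X$ is uniformly convex and $u$ is bounded on $[0,\infty)$, then $\mathrm{Fix}(T)\ne\emptyset$. If moreover $X$ has Opial's property, i.e. for every sequence $x_n\rightharpoonup x$ converging weakly in $X$ one has $\liminf_{n}\|x_n-x\|<\liminf_{n}\|x_n-y\|$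 for all $y\ne x$, then $u(t)$ converges weakly, as $t\to\infty$, to a fixed point of $T$. -/

import Mathlib

open Filter Topology MeasureTheory Set

/-- `u` is a (classical) solution on `[0, ∞)` of the evolution equation
`u'(t) + (I - T) u(t) = f(t)`, `u(0) = x₀`; the derivative at `0` is the one-sided one. -/
structure IsEvolutionSolution {X : Type*} [NormedAddCommGroup X] [NormedSpace ℝ X]
    (T : X → X) (f : ℝ → X) (x₀ : X) (u : ℝ → X) : Prop where
  initial : u 0 = x₀
  equation : ∀ t : ℝ, 0 ≤ t →
    ∃ u' : X, HasDerivWithinAt u u' (Ici 0) t ∧ u' + (u t - T (u t)) = f t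

/-- Weak convergence of `v` to `x` along the filter `l`: convergence in the topology `σ(X, X*)`. -/
def WeaklyTendsto {ι X : Type*} [NormedAddCommGroup X] [NormedSpace ℝ X]
    (v : ι → X) (l : Filter ι) (x : X) : Prop :=
  Tendsto (fun i => toWeakSpace ℝ X (v i)) l (𝓝 (toWeakSpace ℝ X x))

/-- Opial's property: if `xₙ ⇀ x`, then `liminf ‖xₙ - x‖ < liminf ‖xₙ - y‖` for all `y ≠ x`.
Weakly convergent sequences are norm bounded, so both real lower limits are the genuine ones. -/
def OpialProperty (X : Type*) [NormedAddCommGroup X] [NormedSpace ℝ X] : Prop :=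
  ∀ (v : ℕ → X) (x : X), WeaklyTendsto v atTop x → ∀ y : X, y ≠ x →
    liminf (fun n => ‖v n - x‖) atTop < liminf (fun n => ‖v n - y‖) atTop

/-! For a fixed point `p`, nonexpansiveness makes `‖u t - p‖` minus the integral of `ε` over `[0,
t]` nonincreasing; as `ε` is integrable, `‖u t - p‖` converges
(`IsEvolutionSolution.exists_tendsto_norm_sub`). a) Compactness and the vanishing residual give a
limit point of `u` at infinity; it is fixed, so the limit distance to it is 0. b) The asymptotic
center `c` of `u` along an ultrafilter is unique, and `T c` is asymptotically no farther from `u`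
than `c`, so `T c = c`. Under Opial's property, weak subsequential limits are fixed
(`OpialProperty.map_eq_of_weaklyTendsto`), and two distinct ones would each be strictly nearer to
`u` in the limit than the other. They exist by `UniformConvexSpace.exists_subseq_weaklyTendsto`,
proved directly from uniform convexity. -/

/-! ### Asymptotic centers and weak limits along ultrafilters -/

section UniformConvexity

variable {X : Type*} [NormedAddCommGroup X]

/-- A directed family of nonempty sets of arbitrarily small diameter in a complete space
has a common adherent point. -/
theorem exists_forall_mem_closure_of_directed {ι : Type*} [Nonempty ι] [CompleteSpace X]
    {D : ι → Set X} (hdir : Directed (· ≥ ·) D) (hne : ∀ i, (D i).Nonempty)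
    (hdiam : ∀ δ : ℝ, 0 < δ → ∃ i, ∀ x ∈ D i, ∀ y ∈ D i, dist x y < δ) :
    ∃ c, ∀ i, c ∈ closure (D i) := by
  have hdir' : Directed (· ≥ ·) fun i => 𝓟 (D i) := fun i j => by
    obtain ⟨k, hi, hj⟩ := hdir i j
    exact ⟨k, principal_mono.2 hi, principal_mono.2 hj⟩
  have hF : (⨅ i, 𝓟 (D i)).NeBot :=
    iInf_neBot_of_directed hdir' fun i => principal_neBot_iff.2 (hne i)
  have hC : Cauchy (⨅ i, 𝓟 (D i)) := by
    refine Metric.cauchy_iff.2 ⟨hF, fun δ hδ => ?_⟩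
    obtain ⟨i, hi⟩ := hdiam δ hδ
    exact ⟨D i, mem_iInf_of_mem i (mem_principal_self _), hi⟩
  obtain ⟨c, hc⟩ := CompleteSpace.complete hC
  exact ⟨c, fun i => mem_closure_iff_clusterPt.2 (hF.mono (le_inf hc (iInf_le _ i)))⟩

theorem Ultrafilter.exists_tendsto_of_eventually_norm_le {ι : Type*} (l : Ultrafilter ι)
    {g : ι → ℝ} {M : ℝ} (hg : ∀ᶠ i in l, ‖g i‖ ≤ M) : ∃ a, Tendsto g l (𝓝 a) := by
  obtain ⟨a, -, ha⟩ := (isCompact_closedBall (0 : ℝ) M).ultrafilter_le_nhds' (l.map g)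
    (hg.mono fun i hi => mem_closedBall_zero_iff.2 hi :
      ∀ᶠ i in l, g i ∈ Metric.closedBall (0 : ℝ) M)
  exact ⟨a, ha⟩

theorem Ultrafilter.exists_tendsto_norm_sub {ι : Type*} (l : Ultrafilter ι)
    {v : ι → X} {M : ℝ} (hv : ∀ᶠ i in l, ‖v i‖ ≤ M) (y : X) :
    ∃ a, Tendsto (fun i => ‖v i - y‖) l (𝓝 a) :=
  l.exists_tendsto_of_eventually_norm_le (M := M + ‖y‖) (by
    filter_upwards [hv] with i hi
    rw [norm_norm]
    linarith [norm_sub_le (v i) y])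

variable [NormedSpace ℝ X]

/-- Almost-extremal form of uniform convexity: two vectors of norm at most slightly more than `r`
whose midpoint has norm at least slightly less than `r` are close. -/
theorem UniformConvexSpace.exists_forall_norm_sub_lt [UniformConvexSpace X] (r : ℝ) {δ : ℝ}
    (hδ : 0 < δ) :
    ∃ η, 0 < η ∧ ∀ x y : X, ‖x‖ < r + η → ‖y‖ < r + η → 2 * (r - η) ≤ ‖x + y‖ →
      ‖x - y‖ < δ := by
  rcases le_or_gt r 0 with hr | hr
  · refine ⟨δ / 2, by positivity, fun x y hx hy _ => ?_⟩
    linarith [norm_sub_le x y]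
  obtain ⟨κ, hκ, h⟩ := exists_forall_closed_ball_dist_add_le_two_sub X
    (show 0 < δ / (2 * r) by positivity)
  -- After scaling by `(r + η)⁻¹`, `η ≤ r` keeps the separation at least `δ / (2 * r)`, and `4 * η ≤
  -- r * κ` contradicts `2 * (r - η) ≤ (2 - κ) * (r + η)`.
  refine ⟨min r (r * κ / 4), by positivity, fun x y hx hy hxy => ?_⟩
  set η := min r (r * κ / 4) with hη
  have hη0 : 0 < η := by positivity
  have hη1 : η ≤ r := min_le_left _ _
  have hη2 : η ≤ r * κ / 4 := min_le_right _ _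
  have hs : 0 < r + η := by positivity
  have hscale : ∀ z : X, ‖(r + η)⁻¹ • z‖ = ‖z‖ / (r + η) := fun z => by
    rw [norm_smul_of_nonneg (by positivity), div_eq_inv_mul]
  by_contra! hcon
  have h1 := @h ((r + η)⁻¹ • x) (by rw [hscale, div_le_one hs]; exact hx.le)
    ((r + η)⁻¹ • y) (by rw [hscale, div_le_one hs]; exact hy.le) (by
      rw [← smul_sub, hscale]
      exact div_le_div₀ (norm_nonneg _) hcon hs (by linarith))
  rw [← smul_add, hscale, div_le_iff₀ hs] at h1
  nlinarith [mul_pos hη0 hκ]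

/-- A bounded family in a uniformly convex Banach space has a unique asymptotic center along
an ultrafilter. -/
theorem UniformConvexSpace.exists_asymptotic_center [CompleteSpace X] [UniformConvexSpace X]
    {ι : Type*} (l : Ultrafilter ι) {v : ι → X} {M : ℝ} (hv : ∀ᶠ i in l, ‖v i‖ ≤ M) :
    ∃ c, ∀ y a b, Tendsto (fun i => ‖v i - c‖) l (𝓝 a) → Tendsto (fun i => ‖v i - y‖) l (𝓝 b) →
      b ≤ a → y = c := by
  choose φ hφ using l.exists_tendsto_norm_sub hv
  have hφ0 : ∀ y, 0 ≤ φ y := fun y => ge_of_tendsto' (hφ y) fun i => norm_nonneg _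
  have hbdd : BddBelow (range φ) := ⟨0, by rintro _ ⟨y, rfl⟩; exact hφ0 y⟩
  set r := ⨅ y, φ y with hr
  have hrle : ∀ y, r ≤ φ y := fun y => ciInf_le hbdd y
  have hlip : LipschitzWith 1 φ := LipschitzWith.of_le_add fun x y => by
    refine le_of_tendsto_of_tendsto' (hφ x) ((hφ y).add_const (dist x y)) fun i => ?_
    rw [dist_comm, dist_eq_norm]
    simpa using norm_add_le (v i - y) (y - x)
  -- Near-minimizers of `φ` are close together, since `φ` is at least `r` at their midpoint.
  have hclose : ∀ δ : ℝ, 0 < δ → ∃ η, 0 < η ∧ ∀ x y, φ x < r + η → φ y < r + η →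
      ‖x - y‖ < δ := by
    intro δ hδ
    obtain ⟨η, hη, h⟩ := UniformConvexSpace.exists_forall_norm_sub_lt (X := X) r hδ
    refine ⟨η, hη, fun x y hx hy => ?_⟩
    obtain ⟨i, hix, hiy, him⟩ := (((hφ x).eventually_lt_const hx).and
      (((hφ y).eventually_lt_const hy).and
        ((hφ ((2⁻¹ : ℝ) • (x + y))).eventually_const_lt
          (show r - η < _ by linarith [hrle ((2⁻¹ : ℝ) • (x + y))])))).exists
    have key := h _ _ hix hiy (by
      have : v i - x + (v i - y) = (2 : ℝ) • (v i - (2⁻¹ : ℝ) • (x + y)) := by module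
      rw [this, norm_smul_of_nonneg zero_le_two]
      linarith)
    rwa [sub_sub_sub_cancel_left, norm_sub_rev] at key
  have hne : ∀ η : {η : ℝ // 0 < η}, {y | φ y < r + η}.Nonempty := fun η =>
    exists_lt_of_ciInf_lt (show ⨅ y, φ y < r + η by linarith [η.2])
  have : Nonempty {η : ℝ // 0 < η} := ⟨⟨1, one_pos⟩⟩
  obtain ⟨c, hc⟩ := exists_forall_mem_closure_of_directed
    (D := fun η : {η : ℝ // 0 < η} => {y | φ y < r + η})
    (fun a b => ⟨⟨min a b, lt_min a.2 b.2⟩,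
      fun y (hy : φ y < r + min (a : ℝ) b) => lt_of_lt_of_le hy (by gcongr; exact min_le_left _ _),
      fun y (hy : φ y < r + min (a : ℝ) b) =>
        lt_of_lt_of_le hy (by gcongr; exact min_le_right _ _)⟩)
    hne (fun δ hδ => by
      obtain ⟨η, hη, h⟩ := hclose δ hδ
      exact ⟨⟨η, hη⟩, fun x hx y hy => by rw [dist_eq_norm]; exact h x y hx hy⟩)
  have hcr : φ c ≤ r := le_of_forall_pos_le_add fun η hη =>
    closure_minimal (fun y (hy : φ y < r + η) => hy.le)
      (isClosed_le hlip.continuous continuous_const) (hc ⟨η, hη⟩)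
  refine ⟨c, fun y a b ha hb hba => ?_⟩
  rw [tendsto_nhds_unique ha (hφ c), tendsto_nhds_unique hb (hφ y)] at hba
  refine eq_of_forall_dist_le fun δ hδ => ?_
  obtain ⟨η, hη, h⟩ := hclose δ hδ
  rw [dist_eq_norm]
  exact (h y c (by linarith) (by linarith)).le

/-- In a uniformly convex Banach space, the closed convex sets belonging to a bounded ultrafilter
have a common point. -/
theorem UniformConvexSpace.exists_forall_mem_of_ultrafilter [CompleteSpace X]
    [UniformConvexSpace X] (U : Ultrafilter X) {M : ℝ} (hU : Metric.closedBall 0 M ∈ U) :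
    ∃ y, ∀ K ∈ U, IsClosed K → Convex ℝ K → y ∈ K := by
  let I := {K : Set X // K ∈ U ∧ IsClosed K ∧ Convex ℝ K}
  have : Nonempty I := ⟨⟨univ, univ_mem, isClosed_univ, convex_univ⟩⟩
  have hne : ∀ K : I, (K : Set X).Nonempty := fun K => U.nonempty_of_mem K.2.1
  have hbdd : BddAbove (range fun K : I => Metric.infDist 0 (K : Set X)) := by
    refine ⟨M, ?_⟩
    rintro _ ⟨K, rfl⟩
    obtain ⟨z, hzK, hzM⟩ := U.nonempty_of_mem (inter_mem K.2.1 hU)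
    exact (Metric.infDist_le_dist_of_mem hzK).trans (by rwa [dist_comm])
  set r := ⨆ K : I, Metric.infDist 0 (K : Set X) with hr
  have hle : ∀ K : I, Metric.infDist 0 (K : Set X) ≤ r := fun K => le_ciSup hbdd K
  have : Nonempty (I × {η : ℝ // 0 < η}) := ⟨⟨Classical.arbitrary I, ⟨1, one_pos⟩⟩⟩
  obtain ⟨c, hc⟩ := exists_forall_mem_closure_of_directed
    (D := fun p : I × {η : ℝ // 0 < η} => (p.1 : Set X) ∩ Metric.ball 0 (r + p.2))
    (by
      rintro ⟨⟨K, hK, hKc, hKv⟩, a⟩ ⟨⟨L, hL, hLc, hLv⟩, b⟩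
      refine ⟨⟨⟨K ∩ L, inter_mem hK hL, hKc.inter hLc, hKv.inter hLv⟩,
        ⟨min a b, lt_min a.2 b.2⟩⟩, ?_, ?_⟩
      · exact inter_subset_inter inter_subset_left
          (Metric.ball_subset_ball (by gcongr; exact min_le_left _ _))
      · exact inter_subset_inter inter_subset_right
          (Metric.ball_subset_ball (by gcongr; exact min_le_right _ _)))
    (by
      rintro ⟨K, η⟩
      obtain ⟨z, hz, hzr⟩ := (Metric.infDist_lt_iff (hne K)).1
        (show Metric.infDist 0 (K : Set X) < r + η by linarith [hle K, η.2])
      exact ⟨z, hz, by rwa [Metric.mem_ball, dist_comm]⟩)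
    (by
      intro δ hδ
      obtain ⟨η, hη, h⟩ := UniformConvexSpace.exists_forall_norm_sub_lt (X := X) r hδ
      -- Convexity keeps midpoints in `K`, hence at norm above `r - η`.
      obtain ⟨K, hK⟩ := exists_lt_of_lt_ciSup (show r - η < ⨆ K : I, Metric.infDist 0 (K : Set X)
        by linarith)
      refine ⟨⟨K, ⟨η, hη⟩⟩, fun x hx y hy => ?_⟩
      rw [dist_eq_norm]
      refine h x y (mem_ball_zero_iff.1 hx.2) (mem_ball_zero_iff.1 hy.2) ?_
      have hmid : (2⁻¹ : ℝ) • x + (2⁻¹ : ℝ) • y ∈ (K : Set X) :=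
        K.2.2.2 hx.1 hy.1 (by norm_num) (by norm_num) (by norm_num)
      have h1 := hK.trans_le (Metric.infDist_le_dist_of_mem hmid)
      have h2 : x + y = (2 : ℝ) • ((2⁻¹ : ℝ) • x + (2⁻¹ : ℝ) • y) := by module
      rw [dist_zero_left] at h1
      rw [h2, norm_smul_of_nonneg zero_le_two]
      linarith)
  exact ⟨c, fun K hK hKc hKv => closure_minimal inter_subset_left hKc
    (hc ⟨⟨K, hK, hKc, hKv⟩, ⟨1, one_pos⟩⟩)⟩

/-- If `g` tends to `a` along `U`, the closed convex slabs `|g - a| ≤ δ` belong to `U`, so the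
common point lies in all of them. -/
theorem UniformConvexSpace.exists_forall_tendsto_of_ultrafilter [CompleteSpace X]
    [UniformConvexSpace X] (U : Ultrafilter X) {M : ℝ} (hU : Metric.closedBall 0 M ∈ U) :
    ∃ y, (∀ K ∈ U, IsClosed K → Convex ℝ K → y ∈ K) ∧
      ∀ g : StrongDual ℝ X, Tendsto g U (𝓝 (g y)) := by
  obtain ⟨y, hy⟩ := UniformConvexSpace.exists_forall_mem_of_ultrafilter U hU
  refine ⟨y, hy, fun g => ?_⟩
  obtain ⟨a, ha⟩ := U.exists_tendsto_of_eventually_norm_le (g := g) (M := ‖g‖ * M) (by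
    filter_upwards [hU] with x hx
    exact g.le_opNorm_of_le (mem_closedBall_zero_iff.1 hx))
  suffices g y = a by rwa [this]
  refine eq_of_forall_dist_le fun δ hδ => ?_
  exact hy (g ⁻¹' Metric.closedBall a δ) (ha (Metric.closedBall_mem_nhds a hδ))
    (Metric.isClosed_closedBall.preimage g.continuous)
    ((convex_closedBall a δ).linear_preimage g.toLinearMap)

end UniformConvexity

/-! ### Weak sequential compactness and demiclosedness -/

section WeakConvergence

variable {X : Type*} [NormedAddCommGroup X] [NormedSpace ℝ X]

theorem weaklyTendsto_iff {ι : Type*} {v : ι → X} {l : Filter ι} {x : X} :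
    WeaklyTendsto v l x ↔ ∀ g : StrongDual ℝ X, Tendsto (fun i => g (v i)) l (𝓝 (g x)) :=
  WeakBilin.tendsto_iff_forall_eval_tendsto _ fun _ _ h =>
    (SeparatingDual.eq_iff_forall_dual_eq (R := ℝ)).2 fun g => DFunLike.congr_fun h g

/-- A separable set in a normed space admits a sequence of functionals that vanish jointly only
at zero on it. -/
theorem exists_seq_dual_separating {S : Set X} (hS : TopologicalSpace.IsSeparable S)
    (hne : S.Nonempty) :
    ∃ g : ℕ → StrongDual ℝ X, ∀ x ∈ S, (∀ n, g n x = 0) → x = 0 := by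
  obtain ⟨D, hD, hSD⟩ := hS
  have hDne : D.Nonempty := closure_nonempty_iff.1 (hne.mono hSD)
  obtain ⟨d, rfl⟩ := hD.exists_eq_range hDne
  choose g hg1 hg2 using fun n => exists_dual_vector'' ℝ (d n)
  refine ⟨g, fun x hx h0 => ?_⟩
  by_contra hx0
  have hpos : 0 < ‖x‖ := norm_pos_iff.2 hx0
  obtain ⟨_, ⟨n, rfl⟩, hn⟩ := Metric.mem_closure_iff.1 (hSD hx) (‖x‖ / 2) (by positivity)
  rw [dist_eq_norm] at hn
  have h1 : ‖d n‖ ≤ ‖x - d n‖ := by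
    have h2 : g n (d n - x) = ‖d n‖ := by
      rw [map_sub, h0 n, sub_zero]; exact hg2 n
    have h3 := (g n).le_of_opNorm_le (hg1 n) (d n - x)
    rw [h2, one_mul, norm_norm] at h3
    rwa [norm_sub_rev]
  have h4 := norm_add_le (x - d n) (d n)
  rw [sub_add_cancel] at h4
  linarith

/-- Bounded sequences in a uniformly convex Banach space have weakly convergent subsequences. -/
theorem UniformConvexSpace.exists_subseq_weaklyTendsto [CompleteSpace X] [UniformConvexSpace X]
    {v : ℕ → X} {M : ℝ} (hv : ∀ n, ‖v n‖ ≤ M) :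
    ∃ (y : X) (φ : ℕ → ℕ), StrictMono φ ∧ WeaklyTendsto (v ∘ φ) atTop y := by
  let Y : Submodule ℝ X := (Submodule.span ℝ (range v)).topologicalClosure
  have hYsep : TopologicalSpace.IsSeparable (Y : Set X) := by
    have := ((countable_range v).isSeparable.span (R := ℝ)).closure
    rwa [← Submodule.topologicalClosure_coe] at this
  have hvY : ∀ n, v n ∈ Y := fun n =>
    Submodule.le_topologicalClosure _ (Submodule.subset_span (mem_range_self n))
  obtain ⟨g, hg⟩ := exists_seq_dual_separating hYsep ⟨0, Y.zero_mem⟩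
  -- Compactness of a countable product replaces a diagonal argument: all `g k` converge along one
  -- subsequence, and as they separate points of `Y`, all ultrafilter limits coincide.
  obtain ⟨a, -, φ, hφ, ha⟩ := (isCompact_univ_pi fun k =>
      isCompact_closedBall (0 : ℝ) (‖g k‖ * M)).tendsto_subseq
    (x := fun n k => g k (v n)) fun n k _ =>
      mem_closedBall_zero_iff.2 ((g k).le_opNorm_of_le (hv n))
  rw [tendsto_pi_nhds] at ha
  have hlim : ∀ V : Ultrafilter ℕ, ∃ y ∈ Y, ∀ h : StrongDual ℝ X,
      Tendsto (fun n => h (v (φ n))) V (𝓝 (h y)) := fun V => by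
    obtain ⟨y, hyK, hy⟩ := UniformConvexSpace.exists_forall_tendsto_of_ultrafilter
      (V.map (v ∘ φ)) (M := M)
      (Eventually.of_forall fun n => mem_closedBall_zero_iff.2 (hv (φ n)) :
        ∀ᶠ n in V, v (φ n) ∈ Metric.closedBall (0 : X) M)
    exact ⟨y, hyK Y (Eventually.of_forall fun n => hvY (φ n) : ∀ᶠ n in V, v (φ n) ∈ Y)
      (Submodule.isClosed_topologicalClosure _) Y.convex, fun h => hy h⟩
  obtain ⟨y, hyY, hy⟩ := hlim (Ultrafilter.of atTop)
  refine ⟨y, φ, hφ, weaklyTendsto_iff.2 fun h => (tendsto_iff_ultrafilter _ _ _).2 fun V hV => ?_⟩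
  obtain ⟨z, hzY, hz⟩ := hlim V
  suffices y = z by rw [this]; exact hz h
  refine sub_eq_zero.1 (hg _ (Y.sub_mem hyY hzY) fun k => ?_)
  rw [map_sub, sub_eq_zero, tendsto_nhds_unique (hy (g k)) ((ha k).mono_left
    (Ultrafilter.of_le _)), tendsto_nhds_unique (hz (g k)) ((ha k).mono_left hV)]

/-- Under Opial's property, if `‖vₙ - x‖` and `‖vₙ - y‖` converge and `vₙ ⇀ x`, the first limit is
strictly smaller unless `y = x`. -/
theorem OpialProperty.lt_of_tendsto (hO : OpialProperty X) {v : ℕ → X} {x y : X} {a b : ℝ}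
    (hv : WeaklyTendsto v atTop x) (hxy : y ≠ x)
    (ha : Tendsto (fun n => ‖v n - x‖) atTop (𝓝 a))
    (hb : Tendsto (fun n => ‖v n - y‖) atTop (𝓝 b)) : a < b := by
  simpa only [ha.liminf_eq, hb.liminf_eq] using hO v x hv y hxy

/-- Demiclosedness of `I - T` at zero for nonexpansive `T` under Opial's property. -/
theorem OpialProperty.map_eq_of_weaklyTendsto (hO : OpialProperty X) {T : X → X}
    (hT : LipschitzWith 1 T) {v : ℕ → X} {x : X} {M : ℝ} (hM : ∀ n, ‖v n‖ ≤ M)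
    (hv : WeaklyTendsto v atTop x) (hres : Tendsto (fun n => ‖v n - T (v n)‖) atTop (𝓝 0)) :
    T x = x := by
  have hbd : ∀ (z : X) n, ‖v n - z‖ ∈ Metric.closedBall (0 : ℝ) (M + ‖z‖) := fun z n => by
    rw [mem_closedBall_zero_iff, norm_norm]
    linarith [norm_sub_le (v n) z, hM n]
  obtain ⟨⟨a, b⟩, -, φ, hφ, hab⟩ := ((isCompact_closedBall (0 : ℝ) (M + ‖x‖)).prod
    (isCompact_closedBall (0 : ℝ) (M + ‖T x‖))).tendsto_subseq
    (x := fun n => (‖v n - x‖, ‖v n - T x‖)) fun n => ⟨hbd x n, hbd (T x) n⟩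
  rw [Prod.tendsto_iff] at hab
  by_contra hne
  have hlt := hO.lt_of_tendsto (v := v ∘ φ) (hv.comp hφ.tendsto_atTop) hne hab.1 hab.2
  have hle : b ≤ 0 + a := le_of_tendsto_of_tendsto' hab.2
    ((hres.comp hφ.tendsto_atTop).add hab.1) fun n => by
      have h1 : ‖T (v (φ n)) - T x‖ ≤ ‖v (φ n) - x‖ := by
        simpa using hT.norm_sub_le (v (φ n)) x
      have h2 := norm_add_le (v (φ n) - T (v (φ n))) (T (v (φ n)) - T x)
      rw [sub_add_sub_cancel] at h2
      exact h2.trans (by simpa using h1)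
  linarith

end WeakConvergence

/-! ### Distance to fixed points along the flow, and convergence -/

section Evolution

theorem tendsto_of_isCompact_closure_image {X : Type*} [NormedAddCommGroup X]
    {T : X → X} (hT : LipschitzWith 1 T) {u : ℝ → X}
    (hres : Tendsto (fun t : ℝ => ‖u t - T (u t)‖) atTop (𝓝 0))
    (hconv : ∀ p, T p = p → ∃ a, Tendsto (fun t => ‖u t - p‖) atTop (𝓝 a))
    {C : Set X} (hC : ∀ t : ℝ, 0 ≤ t → u t ∈ C) (hcomp : IsCompact (closure (T '' C))) :
    ∃ p ∈ Function.fixedPoints T, Tendsto u atTop (𝓝 p) := by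
  obtain ⟨p, -, φ, hφ, hp⟩ := hcomp.tendsto_subseq (x := fun n : ℕ => T (u n))
    fun n => subset_closure (mem_image_of_mem T (hC n n.cast_nonneg))
  have hφt : Tendsto (fun n => (φ n : ℝ)) atTop atTop :=
    tendsto_natCast_atTop_atTop.comp hφ.tendsto_atTop
  have hup : Tendsto (fun n => u (φ n)) atTop (𝓝 p) := by
    have h := (tendsto_zero_iff_norm_tendsto_zero.2 (hres.comp hφt)).add hp
    simpa using h
  have hfix : T p = p := tendsto_nhds_unique ((hT.continuous.tendsto p).comp hup) hp
  obtain ⟨a, ha⟩ := hconv p hfix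
  have ha0 : a = 0 :=
    tendsto_nhds_unique (ha.comp hφt) (tendsto_iff_norm_sub_tendsto_zero.1 hup)
  exact ⟨p, hfix, tendsto_iff_norm_sub_tendsto_zero.2 (ha0 ▸ ha)⟩

variable {X : Type*} [NormedAddCommGroup X] [NormedSpace ℝ X]

theorem IsEvolutionSolution.continuousOn {T : X → X} {f : ℝ → X} {x₀ : X} {u : ℝ → X}
    (hu : IsEvolutionSolution T f x₀ u) : ContinuousOn u (Ici 0) := fun t ht =>
  let ⟨_, h, _⟩ := hu.equation t ht
  h.continuousWithinAt

/-- The distance of a solution to a fixed point grows at most by the integral of the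
perturbation bound. -/
theorem IsEvolutionSolution.norm_sub_le_add_integral {T : X → X} (hT : LipschitzWith 1 T)
    {f : ℝ → X} {ε : ℝ → ℝ} (hε : ContinuousOn ε (Ici 0)) (hfε : ∀ t : ℝ, 0 ≤ t → ‖f t‖ ≤ ε t)
    {x₀ : X} {u : ℝ → X} (hu : IsEvolutionSolution T f x₀ u) {p : X} (hp : T p = p)
    {s t : ℝ} (hs : 0 ≤ s) (hst : s ≤ t) :
    ‖u t - p‖ ≤ ‖u s - p‖ + ∫ τ in s..t, ε τ := by
  have hεi : ∀ x ∈ Icc s t, IntervalIntegrable ε volume s x := fun x hx =>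
    (hε.mono fun y hy => hs.trans (by rw [uIcc_of_le hx.1] at hy; exact hy.1)).intervalIntegrable
  have hεc : ContinuousOn ε (Icc s t) := hε.mono fun y hy => hs.trans hy.1
  refine image_le_of_liminf_slope_right_le_deriv_boundary (a := s) (b := t)
    (f := fun t => ‖u t - p‖) (B := fun t => ‖u s - p‖ + ∫ τ in s..t, ε τ) (B' := ε)
    ?_ (by simp) ?_ ?_ ?_ (right_mem_Icc.2 hst)
  · exact ((hu.continuousOn.mono fun y hy => hs.trans hy.1).sub continuousOn_const).norm
  · have := intervalIntegral.continuousOn_primitive_interval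
      (f := ε) (μ := volume) (a := s) (b := t)
      (by rw [uIcc_of_le hst]; exact hεc.integrableOn_Icc)
    rw [uIcc_of_le hst] at this
    exact continuousOn_const.add this
  · intro x hx
    refine HasDerivWithinAt.const_add _ ?_
    have hx0 : 0 ≤ x := hs.trans hx.1
    have hcx : ContinuousWithinAt ε (Ioi x) x :=
      (hε x hx0).mono fun y hy => hx0.trans (le_of_lt hy)
    refine intervalIntegral.integral_hasDerivWithinAt_right (hεi x ⟨hx.1, hx.2.le⟩) ?_ hcx
    refine ⟨Ioi x, self_mem_nhdsWithin, ?_⟩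
    exact (hε.mono fun y hy => hx0.trans (le_of_lt hy)).aestronglyMeasurable measurableSet_Ioi
  · intro x hx r hr
    have hx0 : 0 ≤ x := hs.trans hx.1
    obtain ⟨u', hu', heq⟩ := hu.equation x hx0
    have hsl : Tendsto (slope u x) (𝓝[>] x) (𝓝 u') :=
      (hasDerivWithinAt_iff_tendsto_slope' self_notMem_Ioi).1
        (hu'.mono fun y hy => hx0.trans (le_of_lt hy))
    have hev : ∀ᶠ z in 𝓝[>] x, ‖slope u x z - u'‖ < r - ε x := by
      have := (tendsto_iff_norm_sub_tendsto_zero.1 hsl).eventually_lt_const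
        (show (0 : ℝ) < r - ε x by linarith)
      exact this
    -- Makes the weight `1 - (z - x)` nonnegative in the Euler-step decomposition `hdec`.
    have hev2 : ∀ᶠ z in 𝓝[>] x, z < x + 1 :=
      nhdsWithin_le_nhds (Iio_mem_nhds (by linarith))
    refine Eventually.frequently ?_
    filter_upwards [hev, hev2, self_mem_nhdsWithin] with z hz hz1 hxz
    have hh : 0 < z - x := sub_pos.2 hxz
    rw [slope_def_field, div_lt_iff₀ hh]
    have hslope : (z - x) • slope u x z = u z - u x := sub_smul_slope u x z
    have hdec : u z - p = (z - x) • (slope u x z - u') +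
        ((1 - (z - x)) • (u x - p) + (z - x) • (T (u x) - T p) + (z - x) • f x) := by
      rw [smul_sub, hslope, ← heq, hp]
      module
    have hTn : ‖T (u x) - T p‖ ≤ ‖u x - p‖ := by simpa using hT.norm_sub_le (u x) p
    have hb : ‖u z - p‖ ≤ (z - x) * ‖slope u x z - u'‖ +
        ((1 - (z - x)) * ‖u x - p‖ + (z - x) * ‖u x - p‖ + (z - x) * ε x) := by
      rw [hdec]
      refine (norm_add_le _ _).trans (add_le_add ?_ (norm_add₃_le.trans ?_))
      · rw [norm_smul_of_nonneg hh.le]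
      · rw [norm_smul_of_nonneg hh.le, norm_smul_of_nonneg hh.le,
          norm_smul_of_nonneg (by linarith)]
        gcongr
        exact hfε x hx0
    nlinarith [mul_lt_mul_of_pos_left hz hh]

theorem IsEvolutionSolution.exists_tendsto_norm_sub {T : X → X} (hT : LipschitzWith 1 T)
    {f : ℝ → X} {ε : ℝ → ℝ} (hε : ContinuousOn ε (Ici 0)) (hfε : ∀ t : ℝ, 0 ≤ t → ‖f t‖ ≤ ε t)
    (hint : IntegrableOn ε (Ici 0) volume)
    {x₀ : X} {u : ℝ → X} (hu : IsEvolutionSolution T f x₀ u) {p : X} (hp : T p = p) :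
    ∃ a, Tendsto (fun t => ‖u t - p‖) atTop (𝓝 a) := by
  have hlim := intervalIntegral_tendsto_integral_Ioi (μ := volume) (f := ε) 0
    (hint.mono_set Ioi_subset_Ici_self) tendsto_id
  have hε0 : ∀ t, 0 ≤ t → 0 ≤ ε t := fun t ht => (norm_nonneg _).trans (hfε t ht)
  have hεi : ∀ s t : ℝ, 0 ≤ s → 0 ≤ t → IntervalIntegrable ε volume s t := fun s t hs ht =>
    (hε.mono fun y hy => (le_min hs ht).trans hy.1).intervalIntegrable
  -- Truncating time at 0 makes `ψ` antitone on all of `ℝ`, although `u` is controlled only on `[0,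
  -- ∞)`.
  let ψ : ℝ → ℝ := fun t => ‖u (max 0 t) - p‖ - ∫ τ in (0 : ℝ)..max 0 t, ε τ
  have hanti : Antitone ψ := fun s t hst => by
    have h0 : (0 : ℝ) ≤ max 0 s := le_max_left _ _
    have h1 : max 0 s ≤ max 0 t := max_le_max_left _ hst
    have h2 := hu.norm_sub_le_add_integral hT hε hfε hp h0 h1
    have h3 := intervalIntegral.integral_add_adjacent_intervals
      (hεi 0 _ le_rfl h0) (hεi _ _ h0 (h0.trans h1))
    simp only [ψ]
    linarith
  have hbdd : BddBelow (range ψ) := by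
    refine ⟨-∫ τ in Ioi (0 : ℝ), ε τ, ?_⟩
    rintro _ ⟨t, rfl⟩
    have h1 : ∫ τ in (0 : ℝ)..max 0 t, ε τ ≤ ∫ τ in Ioi (0 : ℝ), ε τ := by
      rw [intervalIntegral.integral_of_le (le_max_left _ _)]
      exact setIntegral_mono_set (hint.mono_set Ioi_subset_Ici_self)
        ((ae_restrict_iff' measurableSet_Ioi).2 (Eventually.of_forall fun y hy =>
          hε0 y (le_of_lt hy))) (Eventually.of_forall Ioc_subset_Ioi_self)
    simp only [ψ]
    linarith [norm_nonneg (u (max 0 t) - p)]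
  refine ⟨_, ((tendsto_atTop_ciInf hanti hbdd).add hlim).congr' ?_⟩
  filter_upwards [eventually_ge_atTop 0] with t ht
  simp [ψ, max_eq_right ht]

/-- A nonexpansive map with a bounded approximate fixed point net in a uniformly convex Banach
space has a fixed point. -/
theorem fixedPoints_nonempty_of_tendsto_norm_sub [CompleteSpace X] [UniformConvexSpace X]
    {T : X → X} (hT : LipschitzWith 1 T) {ι : Type*} {l : Filter ι} [l.NeBot] {v : ι → X} {M : ℝ}
    (hM : ∀ᶠ i in l, ‖v i‖ ≤ M) (hres : Tendsto (fun i => ‖v i - T (v i)‖) l (𝓝 0)) :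
    (Function.fixedPoints T).Nonempty := by
  have hM' : ∀ᶠ i in Ultrafilter.of l, ‖v i‖ ≤ M := Ultrafilter.of_le l hM
  obtain ⟨c, hc⟩ := UniformConvexSpace.exists_asymptotic_center (Ultrafilter.of l) hM'
  obtain ⟨a, ha⟩ := (Ultrafilter.of l).exists_tendsto_norm_sub hM' c
  obtain ⟨b, hb⟩ := (Ultrafilter.of l).exists_tendsto_norm_sub hM' (T c)
  refine ⟨c, hc (T c) a b ha hb ?_⟩
  rw [← zero_add a]
  refine le_of_tendsto_of_tendsto' hb ((hres.mono_left (Ultrafilter.of_le l)).add ha) fun i => ?_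
  have h1 : ‖T (v i) - T c‖ ≤ ‖v i - c‖ := by simpa using hT.norm_sub_le (v i) c
  have h2 := norm_add_le (v i - T (v i)) (T (v i) - T c)
  rw [sub_add_sub_cancel] at h2
  linarith

theorem OpialProperty.exists_weaklyTendsto [CompleteSpace X] [UniformConvexSpace X]
    (hO : OpialProperty X) {T : X → X} (hT : LipschitzWith 1 T) {u : ℝ → X} {M : ℝ}
    (hM : ∀ t, 0 ≤ t → ‖u t‖ ≤ M)
    (hres : Tendsto (fun t : ℝ => ‖u t - T (u t)‖) atTop (𝓝 0))
    (hconv : ∀ p, T p = p → ∃ a, Tendsto (fun t => ‖u t - p‖) atTop (𝓝 a)) :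
    ∃ p ∈ Function.fixedPoints T, WeaklyTendsto u atTop p := by
  have hsub : ∀ ns : ℕ → ℝ, Tendsto ns atTop atTop → ∃ (q : X) (ms : ℕ → ℕ), T q = q ∧
      Tendsto (fun n => ns (ms n)) atTop atTop ∧
      WeaklyTendsto (fun n => u (ns (ms n))) atTop q := by
    intro ns hns
    obtain ⟨N, hN⟩ := eventually_atTop.1 (hns.eventually_ge_atTop 0)
    have hbd : ∀ n, ‖u (ns (n + N))‖ ≤ M := fun n => hM _ (hN _ (Nat.le_add_left _ _))
    obtain ⟨q, φ, hφ, hq⟩ := UniformConvexSpace.exists_subseq_weaklyTendsto hbd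
    have hms : Tendsto (fun n => ns (φ n + N)) atTop atTop :=
      hns.comp ((tendsto_add_atTop_nat N).comp hφ.tendsto_atTop)
    exact ⟨q, fun n => φ n + N,
      hO.map_eq_of_weaklyTendsto hT (fun n => hbd (φ n)) hq (hres.comp hms), hms, hq⟩
  obtain ⟨p, ms, hp, hms, hpw⟩ := hsub (fun n => n) tendsto_natCast_atTop_atTop
  refine ⟨p, hp, tendsto_of_subseq_tendsto fun ns hns => ?_⟩
  obtain ⟨q, ks, hq, hks, hqw⟩ := hsub ns hns
  refine ⟨ks, ?_⟩
  suffices q = p by rw [← this]; exact hqw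
  by_contra hne
  obtain ⟨a, ha⟩ := hconv p hp
  obtain ⟨b, hb⟩ := hconv q hq
  -- The limits `a` and `b` are taken over all `t`, so they are the same along both sequences.
  exact lt_asymm (hO.lt_of_tendsto hpw hne (ha.comp hms) (hb.comp hms))
    (hO.lt_of_tendsto hqw (Ne.symm hne) (hb.comp hks) (ha.comp hks))

end Evolution

theorem mainTheorem9 {X : Type*} [NormedAddCommGroup X] [NormedSpace ℝ X] [CompleteSpace X]
    (T : X → X) (hT : LipschitzWith 1 T)
    (f : ℝ → X) (hf : ContinuousOn f (Ici 0))
    (ε : ℝ → ℝ) (hε : ContinuousOn ε (Ici 0)) (hfε : ∀ t : ℝ, 0 ≤ t → ‖f t‖ ≤ ε t)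
    (hint : IntegrableOn ε (Ici 0) volume)
    (x₀ : X) (u : ℝ → X) (hu : IsEvolutionSolution T f x₀ u)
    (hres : Tendsto (fun t : ℝ => ‖u t - T (u t)‖) atTop (𝓝 0)) :
    (∀ C : Set X, (∀ t : ℝ, 0 ≤ t → u t ∈ C) → IsCompact (closure (T '' C)) →
      ∃ p ∈ Function.fixedPoints T, Tendsto u atTop (𝓝 p)) ∧
    (UniformConvexSpace X → Bornology.IsBounded (u '' Ici 0) →
      (Function.fixedPoints T).Nonempty ∧
      (OpialProperty X → ∃ p ∈ Function.fixedPoints T, WeaklyTendsto u atTop p)) := by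
  have hconv : ∀ p, T p = p → ∃ a, Tendsto (fun t => ‖u t - p‖) atTop (𝓝 a) := fun p hp =>
    hu.exists_tendsto_norm_sub hT hε hfε hint hp
  refine ⟨fun C hC hcomp => tendsto_of_isCompact_closure_image hT hres hconv hC hcomp,
    fun hUC hbdd => ?_⟩
  obtain ⟨M, hM⟩ := hbdd.exists_norm_le
  have hM' : ∀ t, 0 ≤ t → ‖u t‖ ≤ M := fun t ht => hM _ (mem_image_of_mem u ht)
  exact ⟨fixedPoints_nonempty_of_tendsto_norm_sub hT
      ((eventually_ge_atTop 0).mono hM') hres,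
    fun hO => hO.exists_weaklyTendsto hT hM' hres hconv⟩
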